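/- Let $G$ be a group and $X$ a set on which $G$ acts. The action is *amenable* if there is a $G$-invariant mean on $\ell^\infty(X)$, that is, a linear functional $m:\ell^\infty(X)\to\mathbb{C}$ with $m(1)=1$, $m(f)\ge 0$ whenever $f\ge 0$, and $m({}_gf)=m(f)$ for all $g\in G$ and $f\in \ell^\infty(X)$, where ${}_gf(x)=f(g^{-1}x)$. The action is *f.s.o.* (finite stabilizers orbits) if, for all $x,y\in X$, the orbit $G_x\,y$ of $y$ under the stabilizer $G_x$ of $x$ is finite. Let $\mathcal{A}_1$ be the class of all countably infinite groups that admit a faithful, transitive, amenable f.s.o. action on some set. For a class $\mathcal{C}$ of groups, a group $\Gamma$ is *residually $\mathcal{C}$* if for every $g\in \Gamma$, $g\neq e$, there is a normal subgroup $N$ of $\Gamma$ such that $g\notin N$ and $\Gamma/N$ belongs to $\mathcal{C}$. Let $\mathcal{A}_{fin}$ be the class of finite groups. **Proposition.** Let $G$ be a group in the class $\mathcal{A}_1$ and let $G_1$ be a subgroup of $G$. Then $G_1$ is residually $\mathcal{A}_1\cup\mathcal{A}_{fin}$. -/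

import Mathlib

open scoped ENNReal ComplexOrder

universe u v

/-- The algebra `ℓ^∞(X)` of bounded complex-valued functions on the set `X`. -/
abbrev EllInfty (X : Type v) : Type v := lp (fun _ : X => ℂ) ∞

/-- The translate of `f ∈ ℓ^∞(X)` by `g`: the function `x ↦ f (g⁻¹ x)`. -/
def EllInfty.translate {G : Type u} [Group G] {X : Type v} [MulAction G X] (g : G)
    (f : EllInfty X) : EllInfty X :=
  ⟨fun x => f (g⁻¹ • x), by
    apply memℓp_infty
    obtain ⟨C, hC⟩ := memℓp_infty_iff.mp (lp.memℓp f)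
    refine ⟨C, ?_⟩
    rintro _ ⟨x, rfl⟩
    exact hC ⟨g⁻¹ • x, rfl⟩⟩

/-- A mean on `ℓ^∞(X)`: a unital positive linear functional. (There is none if `X` is empty.) -/
structure IsMean {X : Type v} (m : EllInfty X →ₗ[ℂ] ℂ) : Prop where
  map_one : m 1 = 1
  map_nonneg : ∀ f : EllInfty X, (∀ x, 0 ≤ f x) → 0 ≤ m f

/-- The action of `G` on the (discrete) set `X` is amenable, in the sense of Greenleaf: there is
a `G`-invariant mean on `ℓ^∞(X)`. -/
def IsAmenableAction (G : Type u) [Group G] (X : Type v) [MulAction G X] : Prop :=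
  ∃ m : EllInfty X →ₗ[ℂ] ℂ, IsMean m ∧
    ∀ (g : G) (f : EllInfty X), m (EllInfty.translate g f) = m f

/-- The action of `G` on `X` is f.s.o. (finite stabilizers orbits): every orbit of every point
stabilizer is finite. -/
def IsFSOAction (G : Type u) [Group G] (X : Type v) [MulAction G X] : Prop :=
  ∀ x y : X, (MulAction.orbit (MulAction.stabilizer G x) y).Finite

/-- The class `𝒜₁` of countably infinite groups that admit a faithful, transitive, amenable f.s.o.
action. The set acted upon is nonempty, since it carries a mean; by transitivity it is in
bijection with a set of cosets of `G`, so that it may be taken in the universe of `G`. -/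
def ClassA1 (G : Type u) [Group G] : Prop :=
  Countable G ∧ Infinite G ∧
    ∃ (X : Type u) (_ : MulAction G X),
      FaithfulSMul G X ∧ MulAction.IsPretransitive G X ∧
        IsAmenableAction G X ∧ IsFSOAction G X

/-- The group `G` is residually `𝒞`, for a class `𝒞` of groups: every `g ≠ 1` lies outside some
normal subgroup `N` of `G` such that `G ⧸ N` belongs to `𝒞`. -/
def IsResidually (𝒞 : (Q : Type u) → [Group Q] → Prop) (G : Type u) [Group G] : Prop :=
  ∀ g : G, g ≠ 1 → ∃ (N : Subgroup G) (_ : N.Normal), g ∉ N ∧ 𝒞 (G ⧸ N)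

/-! Given `g ≠ 1` in `G₁`, faithfulness yields a point `x` moved by `g`; the kernel of the action of
`G₁` on the orbit of `x` then misses `g`, and the quotient acts faithfully and transitively on that
orbit. The crux is amenability there: an invariant mean on `X` may vanish on functions supported on
a single orbit, so it cannot just be restricted. Instead f.s.o. provides an equivariant family of
finite nonempty subsets of the orbit, indexed by `X`; averaging over them sends bounded functions on
the orbit to bounded functions on `X`, where the mean applies. -/

open scoped Pointwise in
/-- If the stabilizer of every point `y` has a finite orbit through `x`, there is an equivariant
assignment of a nonempty finite subset of the orbit of `x` to every point. -/
theorem IsFSOAction.exists_equivariant_finset {Γ : Type u} [Group Γ] {X : Type v} [MulAction Γ X]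
    (h : IsFSOAction Γ X) (x : X) :
    ∃ S : X → Finset (MulAction.orbit Γ x), (∀ y, (S y).Nonempty) ∧
      ∀ (g : Γ) (y : X) (z : MulAction.orbit Γ x), z ∈ S (g • y) ↔ g⁻¹ • z ∈ S y := by
  classical
  let r : X → X := fun y => (Quotient.mk (MulAction.orbitRel Γ X) y).out
  have hr : ∀ y, ∃ t : Γ, t • r y = y := fun y =>
    (MulAction.orbitRel Γ X).symm (Quotient.mk_out (s := MulAction.orbitRel Γ X) y)
  have hrg : ∀ (g : Γ) y, r (g • y) = r y := fun g y => by
    have : (Quotient.mk (MulAction.orbitRel Γ X) (g • y)) = Quotient.mk _ y :=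
      Quotient.sound (s := MulAction.orbitRel Γ X) ⟨g, rfl⟩
    simp only [r, this]
  choose t ht using hr
  -- The stabilizer orbit of `x` at the representative `r y`, transported by `t y`. It is stable
  -- under the stabilizer of `r y`, so the choice of `t y` is immaterial; this gives equivariance.
  let A : X → Set (MulAction.orbit Γ x) := fun y =>
    {z | ((t y)⁻¹ • z : MulAction.orbit Γ x).1 ∈ MulAction.orbit (MulAction.stabilizer Γ (r y)) x}
  have hA : ∀ y, (A y).Finite := fun y =>
    (h (r y) x).preimage
      ((Subtype.val_injective.comp (MulAction.injective ((t y)⁻¹))).injOn)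
  refine ⟨fun y => (hA y).toFinset, fun y => ?_, fun g y z => ?_⟩
  · rw [Set.Finite.toFinset_nonempty]
    refine ⟨t y • ⟨x, MulAction.mem_orbit_self x⟩, ?_⟩
    simp only [A, Set.mem_ofPred_eq, inv_smul_smul]
    exact MulAction.mem_orbit_self x
  · have hs : (t (g • y))⁻¹ * g * t y ∈ MulAction.stabilizer Γ (r y) := by
      rw [MulAction.mem_stabilizer_iff, mul_smul, ht, mul_smul, inv_smul_eq_iff]
      conv_lhs => rw [← ht (g • y)]
      rw [hrg]
    have hz : ((t (g • y))⁻¹ • z : MulAction.orbit Γ x).1 =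
        (⟨_, hs⟩ : MulAction.stabilizer Γ (r y)) • ((t y)⁻¹ • g⁻¹ • z : MulAction.orbit Γ x).1 := by
      simp only [Subgroup.mk_smul, MulAction.orbit.coe_smul, smul_smul]
      congr 1
      group
    simp only [Set.Finite.mem_toFinset, A, Set.mem_ofPred_eq]
    rw [hrg, hz, ← MulAction.orbit_eq_iff, MulAction.orbit_smul, MulAction.orbit_eq_iff]

/-- Averaging of bounded functions over a family of finite sets. -/
noncomputable def EllInfty.average {X Y : Type v} (S : X → Finset Y) :
    EllInfty Y →ₗ[ℂ] EllInfty X where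
  toFun f := ⟨fun y => ((S y).card : ℂ)⁻¹ * ∑ z ∈ S y, f z, by
    apply memℓp_infty
    refine ⟨‖f‖, ?_⟩
    rintro _ ⟨y, rfl⟩
    dsimp only
    rw [norm_mul, norm_inv, Complex.norm_natCast]
    have h : ‖∑ z ∈ S y, f z‖ ≤ (S y).card * ‖f‖ := by
      refine (norm_sum_le _ _).trans ?_
      rw [← nsmul_eq_mul]
      exact Finset.sum_le_card_nsmul _ _ _ fun z _ => lp.norm_apply_le_norm ENNReal.top_ne_zero f z
    -- Over an empty set the average is `0`, since `0⁻¹ = 0`.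
    rcases (S y).eq_empty_or_nonempty with h0 | h0
    · simp [h0]
    · exact inv_mul_le_of_le_mul₀ (by positivity) (by positivity) h⟩
  map_add' f g := by
    ext y
    change _ = ((S y).card : ℂ)⁻¹ * ∑ z ∈ S y, f z + ((S y).card : ℂ)⁻¹ * ∑ z ∈ S y, g z
    rw [← mul_add, ← Finset.sum_add_distrib]
    rfl
  map_smul' c f := by
    ext y
    simp only [lp.coeFn_smul, Pi.smul_apply, smul_eq_mul, RingHom.id_apply, ← Finset.mul_sum]
    ring

theorem EllInfty.average_apply {X Y : Type v} (S : X → Finset Y) (f : EllInfty Y) (y : X) :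
    EllInfty.average S f y = ((S y).card : ℂ)⁻¹ * ∑ z ∈ S y, f z := rfl

theorem EllInfty.translate_apply {G : Type u} [Group G] {X : Type v} [MulAction G X] (g : G)
    (f : EllInfty X) (x : X) : EllInfty.translate g f x = f (g⁻¹ • x) := rfl

/-- Equivariance makes `g⁻¹` a bijection from `S x` onto `S (g⁻¹ • x)`, which reindexes the sum and
preserves the cardinality. -/
theorem EllInfty.average_translate {Γ : Type u} [Group Γ] {X Y : Type v} [MulAction Γ X]
    [MulAction Γ Y] {S : X → Finset Y}
    (hS : ∀ (g : Γ) (x : X) (y : Y), y ∈ S (g • x) ↔ g⁻¹ • y ∈ S x) (g : Γ) (f : EllInfty Y) :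
    EllInfty.average S (EllInfty.translate g f) = EllInfty.translate g (EllInfty.average S f) := by
  ext x
  have hmem : ∀ y, y ∈ S x ↔ g⁻¹ • y ∈ S (g⁻¹ • x) := fun y => by simp [hS]
  rw [EllInfty.translate_apply, EllInfty.average_apply, EllInfty.average_apply,
    Finset.card_equiv (MulAction.toPerm g⁻¹) hmem,
    Finset.sum_equiv (MulAction.toPerm g⁻¹) hmem fun y _ => EllInfty.translate_apply g f y]

/-- An amenable f.s.o. action is amenable on every orbit. -/
theorem IsAmenableAction.orbit {Γ : Type u} [Group Γ] {X : Type v} [MulAction Γ X]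
    (ha : IsAmenableAction Γ X) (h : IsFSOAction Γ X) (x : X) :
    IsAmenableAction Γ (MulAction.orbit Γ x) := by
  obtain ⟨m, hm, hinv⟩ := ha
  obtain ⟨S, hne, hS⟩ := h.exists_equivariant_finset x
  refine ⟨m ∘ₗ EllInfty.average S, ⟨?_, fun f hf => hm.map_nonneg _ fun y => ?_⟩, fun g f => ?_⟩
  · have h1 : EllInfty.average S 1 = 1 := by
      ext y
      have : ((S y).card : ℂ) ≠ 0 := by simpa using (hne y).ne_empty
      simp [EllInfty.average_apply, this]
    rw [LinearMap.comp_apply, h1, hm.map_one]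
  · rw [EllInfty.average_apply]
    exact mul_nonneg (inv_nonneg.mpr (Nat.cast_nonneg _)) (Finset.sum_nonneg fun z _ => hf z)
  · rw [LinearMap.comp_apply, EllInfty.average_translate hS, hinv, LinearMap.comp_apply]

theorem IsFSOAction.orbit {Γ : Type u} [Group Γ] {X : Type v} [MulAction Γ X]
    (h : IsFSOAction Γ X) (x : X) : IsFSOAction Γ (MulAction.orbit Γ x) := by
  intro y z
  refine ((h y z).preimage Subtype.val_injective.injOn).subset ?_
  rintro _ ⟨⟨g, hg⟩, rfl⟩
  exact ⟨⟨g, congrArg Subtype.val hg⟩, rfl⟩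

theorem IsFSOAction.subgroup {G : Type u} [Group G] {X : Type v} [MulAction G X]
    (h : IsFSOAction G X) (H : Subgroup G) : IsFSOAction H X := by
  intro x y
  refine (h x y).subset ?_
  rintro _ ⟨⟨g, hg⟩, rfl⟩
  exact ⟨⟨g, hg⟩, rfl⟩

theorem IsAmenableAction.subgroup {G : Type u} [Group G] {X : Type v} [MulAction G X]
    (h : IsAmenableAction G X) (H : Subgroup G) : IsAmenableAction H X := by
  obtain ⟨m, hm, hinv⟩ := h
  exact ⟨m, hm, fun g f => hinv g f⟩

/-- The quotient of a countable group by the kernel of a transitive amenable f.s.o. action is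
finite or in the class `𝒜₁`. -/
theorem classA1_or_finite_quotient_ker {Γ : Type u} [Group Γ] [Countable Γ] {Y : Type u}
    [MulAction Γ Y] [MulAction.IsPretransitive Γ Y] (ha : IsAmenableAction Γ Y)
    (h : IsFSOAction Γ Y) :
    ClassA1 (Γ ⧸ (MulAction.toPermHom Γ Y).ker) ∨ Finite (Γ ⧸ (MulAction.toPermHom Γ Y).ker) := by
  rcases finite_or_infinite (Γ ⧸ (MulAction.toPermHom Γ Y).ker) with hfin | hinf
  · exact Or.inr hfin
  let act : MulAction (Γ ⧸ (MulAction.toPermHom Γ Y).ker) Y :=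
    MulAction.compHom Y (QuotientGroup.kerLift (MulAction.toPermHom Γ Y))
  have hcoe : ∀ (g : Γ) (y : Y), (g : Γ ⧸ (MulAction.toPermHom Γ Y).ker) • y = g • y :=
    fun _ _ => rfl
  refine Or.inl ⟨(QuotientGroup.mk_surjective).countable, hinf, Y, act, ⟨fun {p q} hpq => ?_⟩, ⟨fun x y => ?_⟩, ?_, ?_⟩
  · exact QuotientGroup.kerLift_injective (MulAction.toPermHom Γ Y) (Equiv.ext hpq)
  · obtain ⟨g, hg⟩ := MulAction.exists_smul_eq Γ x y
    exact ⟨g, hg⟩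
  · obtain ⟨m, hm, hinv⟩ := ha
    refine ⟨m, hm, fun q f => ?_⟩
    obtain ⟨g, rfl⟩ := QuotientGroup.mk_surjective q
    exact hinv g f
  · intro x y
    refine (h x y).subset ?_
    rintro _ ⟨⟨q, hq⟩, rfl⟩
    obtain ⟨g, rfl⟩ := QuotientGroup.mk_surjective q
    exact ⟨⟨g, hq⟩, rfl⟩

theorem proposition5p3 {G : Type u} [Group G] (hG : ClassA1 G) (G₁ : Subgroup G) :
    IsResidually (fun (Q : Type u) [Group Q] => ClassA1 Q ∨ Finite Q) G₁ := by
  obtain ⟨hc, -, X, _, hf, -, ha, h⟩ := hG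
  intro g hg
  obtain ⟨x, hx⟩ : ∃ x : X, g • x ≠ x := by
    by_contra! hall
    exact hg (FaithfulSMul.eq_of_smul_eq_smul (α := X) fun x => by rw [hall, one_smul])
  refine ⟨(MulAction.toPermHom G₁ (MulAction.orbit G₁ x)).ker, inferInstance, fun hmem => hx ?_,
    classA1_or_finite_quotient_ker ((ha.subgroup G₁).orbit (h.subgroup G₁) x)
      ((h.subgroup G₁).orbit x)⟩
  exact congrArg Subtype.val
    (DFunLike.congr_fun (MonoidHom.mem_ker.mp hmem) ⟨x, MulAction.mem_orbit_self x⟩)
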